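/- Let $f(z)=\sum_{k=0}^\infty a_k z^k$ be an entire function with $a_k>0$ for all $k\ge 0$, and let $q_n = \dfrac{a_{n-1}^2}{a_{n-2}\,a_n}$ for $n\ge 2$ be the second quotients of its Taylor coefficients. Suppose that $$2\sqrt[3]{2}\;\le\; q_2\;\le\; q_3\;\le\; q_4\;\le\;\cdots .$$ Then all but finitely many zeros of $f$ in $\mathbb{C}$ are real and simple; that is, the set of zeros of $f$ that are non-real or multiple is finite. -/

import Mathlib

/-- The second quotients `q_n = a_{n-1}^2 / (a_{n-2} a_n)` of a sequence of Taylor coefficients.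
They are meant, and used, for `n ≥ 2` only. -/
noncomputable def secondQuotient (a : ℕ → ℝ) (n : ℕ) : ℝ :=
  a (n - 1) ^ 2 / (a (n - 2) * a n)

/-- `z` is a simple zero of `f`: `f` vanishes at `z` to order exactly one. -/
def IsSimpleZero (f : ℂ → ℂ) (z : ℂ) : Prop :=
  AnalyticAt ℂ f z ∧ analyticOrderAt f z = 1

/-!
Write `ρ k = a k / a (k + 1)`, so that the ratios `ρ k / ρ (k + 1)` are the reciprocals of the
second quotients and tend to some `t < 1`. If `ρ m ≤ |z| < ρ (m + 1)`, the largest term of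
`∑ a k z ^ k` is the one of degree `m + 1`. Divided by it, the series becomes a bilateral series in
`u = z / |z|` whose coefficients decay super-exponentially, uniformly in `m`. As `|z| → ∞` they
accumulate at the coefficients of the two-variable theta series `∑ t ^ (j(j-1)/2) x ^ j u ^ j`,
`x y = t`, where `x`, `y` are limit points of `|z| / ρ (m + 1)` and `ρ m / |z|`.

If `f` had infinitely many non-real or multiple zeros, they would tend to infinity. At such a zero
not only the rescaled series vanishes but also its imaginary part divided by `Im u`, that is, the
series with `u ^ j` replaced by the Chebyshev polynomial `U_{j-1} (Re u)`; at a real zero this is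
the derivative. Both properties pass to the limit. By the Jacobi triple product, however, the theta
series vanishes on the unit circle only if `x = 1` or `y = 1`, and then it is, up to `u ↦ u⁻¹`,
`(1 + u) (t; t)_∞ |(-t u; t)_∞| ^ 2`, whose Chebyshev counterpart
`(t; t)_∞ |(-t u; t)_∞| ^ 2 ≥ (t; t)_∞ ^ 3` is positive.
-/

open Filter Topology Polynomial

section QSeries

/-- The `q`-Pochhammer symbol `(a; q)_n`. -/
def qPochhammer {R : Type*} [CommRing R] (a q : R) (n : ℕ) : R :=
  ∏ i ∈ Finset.range n, (1 - a * q ^ i)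

/-- The infinite `q`-Pochhammer symbol `(a; q)_∞`. -/
noncomputable def qPochhammerInf {R : Type*} [CommRing R] [TopologicalSpace R] (a q : R) : R :=
  ∏' i : ℕ, (1 - a * q ^ i)

/-- The reciprocal `1 / (q; q)_k`, extended by `0` to negative `k`. In terms of it the Gaussian
binomial coefficient is `(q; q)_{k + l} / ((q; q)_k (q; q)_l)` for all integers `k` and `l`. -/
noncomputable def invQPochhammer {K : Type*} [Field K] (q : K) (k : ℤ) : K :=
  if 0 ≤ k then (qPochhammer q q k.toNat)⁻¹ else 0

/-- The `j`-th term of the bilateral theta series in two variables: `q ^ (j(j-1)/2) * x ^ j` for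
`0 ≤ j`, and `q ^ (|j|(|j|-1)/2) * y ^ |j|` for `j ≤ 0`. When `x * y = q` these are the terms of the
series in the Jacobi triple product, written without division by `q`, which may be `0`. -/
def thetaTerm {R : Type*} [CommRing R] (q x y : R) (j : ℤ) : R :=
  q ^ j.natAbs.choose 2 * (x ^ j.toNat * y ^ (-j).toNat)

lemma choose_two_succ (n : ℕ) : (n + 1).choose 2 = n + n.choose 2 := by
  rw [Nat.choose_succ_succ' n 1, Nat.choose_one_right]

section CommRing

variable {R : Type*} [CommRing R] (q x y : R)

lemma qPochhammer_succ (n : ℕ) : qPochhammer x q (n + 1) = qPochhammer x q n * (1 - x * q ^ n) :=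
  Finset.prod_range_succ _ _

lemma thetaTerm_natCast (n : ℕ) : thetaTerm q x y n = q ^ n.choose 2 * x ^ n := by
  simp [thetaTerm]

lemma thetaTerm_natCast_eq_prod (n : ℕ) :
    thetaTerm q x y n = ∏ i ∈ Finset.range n, x * q ^ i := by
  rw [thetaTerm_natCast, Finset.prod_mul_distrib, Finset.prod_const, Finset.card_range,
    Finset.prod_pow_eq_pow_sum, Finset.sum_range_id, Nat.choose_two_right, mul_comm]

lemma thetaTerm_neg (j : ℤ) : thetaTerm q x y (-j) = thetaTerm q y x j := by
  simp [thetaTerm, mul_comm]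

lemma thetaTerm_neg_natCast (n : ℕ) : thetaTerm q x y (-n) = q ^ n.choose 2 * y ^ n := by
  rw [thetaTerm_neg, thetaTerm_natCast]

lemma map_thetaTerm {S : Type*} [CommRing S] (φ : R →+* S) (j : ℤ) :
    φ (thetaTerm q x y j) = thetaTerm (φ q) (φ x) (φ y) j := by
  simp [thetaTerm]

lemma thetaTerm_mul_mul (c : R) (j : ℤ) :
    thetaTerm q (x * c) (y * c) j = thetaTerm q x y j * c ^ j.natAbs := by
  obtain ⟨n, rfl | rfl⟩ := j.eq_nat_or_neg
  · simp only [thetaTerm_natCast, mul_pow, Int.natAbs_natCast, mul_assoc]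
  · simp only [thetaTerm_neg_natCast, mul_pow, Int.natAbs_neg, Int.natAbs_natCast, mul_assoc]

variable {q x y}

lemma pow_mul_mul_thetaTerm (hxy : x * y = q) {m s : ℕ} {j : ℤ} (hs : (s : ℤ) = m - j) :
    q ^ m * x * thetaTerm q x y j = q ^ s * thetaTerm q x y (j + 1) := by
  obtain ⟨n, rfl | rfl⟩ := j.eq_nat_or_neg
  · obtain rfl : m = s + n := by omega
    rw [← Nat.cast_add_one, thetaTerm_natCast, thetaTerm_natCast, choose_two_succ]
    ring
  · obtain rfl : s = m + n := by omega
    obtain _ | n := n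
    · simp [thetaTerm]
    · rw [show -((n + 1 : ℕ) : ℤ) + 1 = -(n : ℤ) by push_cast; ring, thetaTerm_neg_natCast,
        thetaTerm_neg_natCast, choose_two_succ, ← hxy]
      ring

end CommRing

section Field

variable {K : Type*} [Field K] {q x y : K}

lemma thetaTerm_mul_mul_inv (u : K) (j : ℤ) :
    thetaTerm q (x * u) (y * u⁻¹) j = thetaTerm q x y j * u ^ j := by
  obtain ⟨n, rfl | rfl⟩ := j.eq_nat_or_neg
  · simp only [thetaTerm_natCast, mul_pow, zpow_natCast, mul_assoc]
  · simp only [thetaTerm_neg_natCast, mul_pow, inv_pow, zpow_neg, zpow_natCast, mul_assoc]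

lemma invQPochhammer_natCast (n : ℕ) : invQPochhammer q n = (qPochhammer q q n)⁻¹ := by
  simp [invQPochhammer]

lemma invQPochhammer_of_neg {k : ℤ} (hk : k < 0) : invQPochhammer q k = 0 :=
  if_neg hk.not_ge

lemma one_sub_pow_mul_invQPochhammer (hq : ∀ n : ℕ, 1 - q * q ^ n ≠ 0) (n : ℕ) :
    (1 - q ^ n) * invQPochhammer q n = invQPochhammer q (n - 1) := by
  obtain _ | n := n
  · simp [invQPochhammer]
  · rw [Nat.cast_succ, add_sub_cancel_right, ← Nat.cast_succ, invQPochhammer_natCast,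
      invQPochhammer_natCast, qPochhammer_succ, mul_inv, pow_succ', mul_left_comm,
      mul_inv_cancel₀ (hq n), mul_one]

/-- The recurrence is Pascal's rule for Gaussian binomial coefficients. -/
lemma invQPochhammer_mul_thetaTerm_recurrence (hq : ∀ n : ℕ, 1 - q * q ^ n ≠ 0) (hxy : x * y = q)
    (m n : ℕ) (j : ℤ) :
    (1 - q ^ (m + n + 1)) *
        (invQPochhammer q (n + j) * invQPochhammer q (m + 1 - j) * thetaTerm q x y j) =
      invQPochhammer q (n + j) * invQPochhammer q (m - j) * thetaTerm q x y j +
        q ^ m * x * (invQPochhammer q (n + (j - 1)) * invQPochhammer q (m - (j - 1)) *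
          thetaTerm q x y (j - 1)) := by
  rcases lt_or_ge (n + j) 0 with hp | hp
  · simp [invQPochhammer_of_neg hp, invQPochhammer_of_neg (show n + (j - 1) < 0 by omega)]
  rcases lt_or_ge (m + 1 - j) 0 with hs | hs
  · simp [invQPochhammer_of_neg hs, invQPochhammer_of_neg (show m - j < 0 by omega),
      invQPochhammer_of_neg (show m - (j - 1) < 0 by omega)]
  obtain ⟨p, hp⟩ := Int.eq_ofNat_of_zero_le hp
  obtain ⟨s, hs⟩ := Int.eq_ofNat_of_zero_le hs
  have hrp := one_sub_pow_mul_invQPochhammer hq p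
  have hrs := one_sub_pow_mul_invQPochhammer hq s
  have hθ := pow_mul_mul_thetaTerm hxy (m := m) (s := s) (j := j - 1) (by omega)
  rw [sub_add_cancel] at hθ
  rw [show (n : ℤ) + (j - 1) = p - 1 by omega, show (m : ℤ) - (j - 1) = s by omega,
    show (m : ℤ) - j = s - 1 by omega, hp, hs, ← hrp, ← hrs, show m + n + 1 = s + p by omega,
    pow_add]
  linear_combination
    (-(1 - q ^ p) * invQPochhammer q p * invQPochhammer q s) * hθ

end Field

section TopologicalField

variable {K : Type*} [Field K] [TopologicalSpace K] {q x y : K}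

lemma hasSum_invQPochhammer_mul_thetaTerm_symm {m n : ℕ} {s : K}
    (h : HasSum (fun j : ℤ ↦
      invQPochhammer q (n + j) * invQPochhammer q (m - j) * thetaTerm q x y j) s) :
    HasSum (fun j : ℤ ↦
      invQPochhammer q (m + j) * invQPochhammer q (n - j) * thetaTerm q y x j) s := by
  refine ((Equiv.neg ℤ).hasSum_iff.2 h).congr_fun fun j ↦ ?_
  simp only [Function.comp_apply, Equiv.neg_apply, thetaTerm_neg, sub_neg_eq_add, ← sub_eq_add_neg]
  ring

variable [IsTopologicalRing K]

lemma hasSum_invQPochhammer_mul_thetaTerm_succ (hq : ∀ n : ℕ, 1 - q * q ^ n ≠ 0)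
    (hxy : x * y = q) {m n : ℕ}
    (h : HasSum (fun j : ℤ ↦
      invQPochhammer q (n + j) * invQPochhammer q (m - j) * thetaTerm q x y j)
      (qPochhammer (-x) q m * qPochhammer (-y) q n / qPochhammer q q (m + n))) :
    HasSum (fun j : ℤ ↦
      invQPochhammer q (n + j) * invQPochhammer q ((m + 1 : ℕ) - j) * thetaTerm q x y j)
      (qPochhammer (-x) q (m + 1) * qPochhammer (-y) q n / qPochhammer q q (m + 1 + n)) := by
  have hne := hq (m + n)
  have hshift := ((Equiv.subRight (1 : ℤ)).hasSum_iff.2 h).mul_left (q ^ m * x)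
  refine (hasSum_mul_left_iff hne).1 ?_
  convert! h.add hshift using 1
  · funext j
    rw [← pow_succ', Nat.cast_succ]
    exact invQPochhammer_mul_thetaTerm_recurrence hq hxy m n j
  · rw [show m + 1 + n = m + n + 1 by ring, qPochhammer_succ, qPochhammer_succ]
    field_simp
    ring

/-- The finite form of the Jacobi triple product, due to Cauchy. -/
lemma hasSum_invQPochhammer_mul_thetaTerm (hq : ∀ n : ℕ, 1 - q * q ^ n ≠ 0) (hxy : x * y = q)
    (m n : ℕ) :
    HasSum (fun j : ℤ ↦
      invQPochhammer q (n + j) * invQPochhammer q (m - j) * thetaTerm q x y j)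
      (qPochhammer (-x) q m * qPochhammer (-y) q n / qPochhammer q q (m + n)) := by
  induction m with
  | succ m ih => exact hasSum_invQPochhammer_mul_thetaTerm_succ hq hxy ih
  | zero =>
    induction n with
    | zero =>
      have hzero (j : ℤ) (hj : j ≠ 0) :
          invQPochhammer q j * invQPochhammer q (-j) * thetaTerm q x y j = 0 := by
        rcases hj.lt_or_gt with hj | hj
        · simp [invQPochhammer_of_neg hj]
        · simp [invQPochhammer_of_neg (neg_neg_of_pos hj)]
      simpa [invQPochhammer, qPochhammer, thetaTerm] using hasSum_single 0 hzero
    | succ n ih =>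
      have := hasSum_invQPochhammer_mul_thetaTerm_succ hq ((mul_comm y x).trans hxy)
        (m := n) (n := 0) (by
          convert! hasSum_invQPochhammer_mul_thetaTerm_symm ih using 1
          rw [mul_comm, zero_add, add_zero])
      convert! hasSum_invQPochhammer_mul_thetaTerm_symm this using 1
      rw [mul_comm, zero_add, add_zero]

end TopologicalField

section NormedField

variable {K : Type*} [NormedField K] {q x y : K}

lemma one_sub_mul_pow_ne_zero (hq : ‖q‖ < 1) (n : ℕ) : 1 - q * q ^ n ≠ 0 := by
  intro h
  have : ‖q ^ (n + 1)‖ = 1 := by rw [pow_succ', ← sub_eq_zero.1 h, norm_one]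
  exact (pow_lt_one₀ (norm_nonneg q) hq n.succ_ne_zero).ne (norm_pow q _ ▸ this)

lemma summable_norm_mul_pow (hq : ‖q‖ < 1) (x : K) : Summable fun i : ℕ ↦ ‖-(x * q ^ i)‖ := by
  simp only [norm_neg, norm_mul, norm_pow]
  exact (summable_geometric_of_lt_one (norm_nonneg q) hq).mul_left _

lemma summable_norm_pow_choose_two_mul_pow (hq : ‖q‖ < 1) (x : K) :
    Summable fun n : ℕ ↦ ‖q ^ n.choose 2 * x ^ n‖ := by
  have hratio : Tendsto (fun n : ℕ ↦ ‖q ^ n * x‖) atTop (𝓝 0) := by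
    simpa using ((tendsto_pow_atTop_nhds_zero_of_norm_lt_one hq).mul_const x).norm
  refine summable_of_ratio_norm_eventually_le (r := 1 / 2) (by norm_num) ?_
  filter_upwards [hratio.eventually_le_const one_half_pos] with n hn
  rw [norm_norm, norm_norm, choose_two_succ, pow_add, pow_succ',
    show q ^ n * q ^ n.choose 2 * (x * x ^ n) = q ^ n * x * (q ^ n.choose 2 * x ^ n) by ring,
    norm_mul (q ^ n * x)]
  gcongr

lemma summable_norm_thetaTerm (hq : ‖q‖ < 1) (x y : K) :
    Summable fun j : ℤ ↦ ‖thetaTerm q x y j‖ := by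
  refine .of_nat_of_neg ?_ ?_
  · simpa only [thetaTerm_natCast] using summable_norm_pow_choose_two_mul_pow hq x
  · simpa only [thetaTerm_neg_natCast] using summable_norm_pow_choose_two_mul_pow hq y

variable [CompleteSpace K]

lemma multipliable_one_sub_mul_pow (hq : ‖q‖ < 1) (x : K) :
    Multipliable fun i : ℕ ↦ 1 - x * q ^ i := by
  simpa only [sub_eq_add_neg] using multipliable_one_add_of_summable (summable_norm_mul_pow hq x)

lemma tendsto_qPochhammer (hq : ‖q‖ < 1) (x : K) :
    Tendsto (qPochhammer x q) atTop (𝓝 (qPochhammerInf x q)) :=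
  (multipliable_one_sub_mul_pow hq x).tendsto_prod_tprod_nat

lemma qPochhammerInf_ne_zero (hq : ‖q‖ < 1) (hx : ∀ i : ℕ, 1 - x * q ^ i ≠ 0) :
    qPochhammerInf x q ≠ 0 := by
  simp only [sub_eq_add_neg] at hx
  simpa only [qPochhammerInf, sub_eq_add_neg] using
    tprod_one_add_ne_zero_of_summable hx (summable_norm_mul_pow hq x)

lemma qPochhammerInf_self_ne_zero (hq : ‖q‖ < 1) : qPochhammerInf q q ≠ 0 :=
  qPochhammerInf_ne_zero hq (one_sub_mul_pow_ne_zero hq)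

lemma qPochhammerInf_eq_one_sub_mul (hq : ‖q‖ < 1) (x : K) :
    qPochhammerInf x q = (1 - x) * qPochhammerInf (x * q) q := by
  have hshift (i : ℕ) : 1 - x * q ^ (i + 1) = 1 - x * q * q ^ i := by ring
  rw [qPochhammerInf, tprod_eq_zero_mul' (by
    simpa only [hshift] using multipliable_one_sub_mul_pow hq (x * q))]
  simp only [hshift, pow_zero, mul_one, qPochhammerInf]

lemma map_qPochhammerInf {L : Type*} [CommRing L] [TopologicalSpace L] [T2Space L] {φ : K →+* L}
    (hφ : Continuous φ) (hq : ‖q‖ < 1) (x : K) :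
    φ (qPochhammerInf x q) = qPochhammerInf (φ x) (φ q) := by
  simpa [qPochhammerInf] using (multipliable_one_sub_mul_pow hq x).map_tprod φ hφ

lemma qPochhammerInf_norm_le_norm (hq : ‖q‖ < 1) (hx : ‖x‖ ≤ 1) :
    qPochhammerInf ‖x‖ ‖q‖ ≤ ‖qPochhammerInf x q‖ := by
  refine le_of_tendsto_of_tendsto' (tendsto_qPochhammer (by rwa [norm_norm]) ‖x‖)
    (tendsto_qPochhammer hq x).norm fun n ↦ ?_
  rw [qPochhammer, qPochhammer, norm_prod]
  refine Finset.prod_le_prod (fun i _ ↦ ?_) fun i _ ↦ ?_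
  · exact sub_nonneg.2 (mul_le_one₀ hx (by positivity) (pow_le_one₀ (norm_nonneg q) hq.le))
  · simpa using norm_sub_norm_le 1 (x * q ^ i)

lemma tendsto_invQPochhammer (hq : ‖q‖ < 1) :
    Tendsto (invQPochhammer q) atTop (𝓝 (qPochhammerInf q q)⁻¹) := by
  have htoNat : Tendsto Int.toNat atTop atTop :=
    tendsto_atTop.2 fun n ↦ (eventually_ge_atTop (n : ℤ)).mono fun k hk ↦ by omega
  refine (((tendsto_qPochhammer hq q).inv₀ (qPochhammerInf_self_ne_zero hq)).comp htoNat).congr' ?_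
  filter_upwards [eventually_ge_atTop 0] with k hk
  simp [invQPochhammer, hk]

lemma exists_norm_invQPochhammer_le (hq : ‖q‖ < 1) : ∃ M, ∀ k, ‖invQPochhammer q k‖ ≤ M := by
  obtain ⟨M, hM⟩ := ((tendsto_qPochhammer hq q).inv₀
    (qPochhammerInf_self_ne_zero hq)).norm.bddAbove_range
  refine ⟨M, fun k ↦ ?_⟩
  rcases lt_or_ge k 0 with hk | hk
  · rw [invQPochhammer_of_neg hk, norm_zero]
    exact (norm_nonneg _).trans (hM ⟨0, rfl⟩)
  · rw [invQPochhammer, if_pos hk]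
    exact hM ⟨_, rfl⟩

/-- **Jacobi triple product.** -/
theorem hasSum_thetaTerm (hq : ‖q‖ < 1) (hxy : x * y = q) :
    HasSum (thetaTerm q x y)
      (qPochhammerInf q q * (qPochhammerInf (-x) q * qPochhammerInf (-y) q)) := by
  set Q := qPochhammerInf q q
  have hQ : Q ≠ 0 := qPochhammerInf_self_ne_zero hq
  obtain ⟨M, hM⟩ := exists_norm_invQPochhammer_le hq
  have hdiag : Tendsto (fun n : ℕ ↦ n + n) atTop atTop :=
    tendsto_atTop_mono (fun n ↦ Nat.le_add_left n n) tendsto_id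
  have hprod : Tendsto
      (fun n ↦ qPochhammer (-x) q n * qPochhammer (-y) q n / qPochhammer q q (n + n)) atTop
      (𝓝 (qPochhammerInf (-x) q * qPochhammerInf (-y) q / Q)) :=
    ((tendsto_qPochhammer hq _).mul (tendsto_qPochhammer hq _)).div
      ((tendsto_qPochhammer hq q).comp hdiag) hQ
  have hcoeff (j : ℤ) : Tendsto
      (fun n : ℕ ↦ invQPochhammer q (n + j) * invQPochhammer q (n - j)) atTop (𝓝 (Q⁻¹ * Q⁻¹)) :=
    ((tendsto_invQPochhammer hq).comp
        (tendsto_atTop_add_const_right _ j tendsto_natCast_atTop_atTop)).mul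
      ((tendsto_invQPochhammer hq).comp
        (tendsto_atTop_add_const_right _ (-j) tendsto_natCast_atTop_atTop))
  have hsum := tendsto_tsum_of_dominated_convergence
    ((summable_norm_thetaTerm hq x y).mul_left (M * M))
    (fun j ↦ (hcoeff j).mul_const (thetaTerm q x y j)) (.of_forall fun n j ↦ by
      rw [norm_mul, norm_mul]
      gcongr
      exacts [(norm_nonneg _).trans (hM 0), hM _, hM _])
  simp only [(hasSum_invQPochhammer_mul_thetaTerm (one_sub_mul_pow_ne_zero hq) hxy _ _).tsum_eq,
    tsum_mul_left] at hsum
  convert! (summable_norm_thetaTerm hq x y).of_norm.hasSum using 1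
  have := tendsto_nhds_unique hprod hsum
  field_simp at this
  linear_combination this

lemma exists_eq_zero_of_tsum_thetaTerm_eq_zero (hq : ‖q‖ < 1) (hxy : x * y = q)
    (h : ∑' j, thetaTerm q x y j = 0) :
    ∃ i : ℕ, 1 + x * q ^ i = 0 ∨ 1 + y * q ^ i = 0 := by
  by_contra! hne
  rw [(hasSum_thetaTerm hq hxy).tsum_eq] at h
  refine mul_ne_zero (qPochhammerInf_self_ne_zero hq) (mul_ne_zero ?_ ?_) h <;>
  refine qPochhammerInf_ne_zero hq fun i ↦ ?_
  · simpa using (hne i).1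
  · simpa using (hne i).2

end NormedField

end QSeries

section Chebyshev

lemma im_zpow {u : ℂ} (hu : ‖u‖ = 1) (j : ℤ) :
    (u ^ j).im = (Chebyshev.U ℝ (j - 1)).eval u.re * u.im := by
  obtain ⟨θ, rfl⟩ : ∃ θ : ℝ, Complex.exp (θ * Complex.I) = u :=
    ⟨u.arg, by simpa [hu] using u.norm_mul_exp_arg_mul_I⟩
  rw [← Complex.exp_int_mul, Complex.exp_ofReal_mul_I_re, Complex.exp_ofReal_mul_I_im,
    Chebyshev.U_real_cos, ← mul_assoc, ← Complex.ofReal_intCast, ← Complex.ofReal_mul,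
    Complex.exp_ofReal_mul_I_im, Int.cast_sub, Int.cast_one, sub_add_cancel]

lemma abs_eval_U_natCast_sub_one_le {x : ℝ} (hx : |x| ≤ 1) (n : ℕ) :
    |(Chebyshev.U ℝ (n - 1)).eval x| ≤ n := by
  induction n with
  | zero => simp
  | succ n ih =>
    have hrec := Chebyshev.U_eq_X_mul_U_add_T ℝ ((n : ℤ) - 1)
    rw [sub_add_cancel] at hrec
    rw [Nat.cast_succ, Nat.cast_succ, add_sub_cancel_right, hrec, Polynomial.eval_add,
      Polynomial.eval_mul, Polynomial.eval_X]
    refine (abs_add_le _ _).trans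
      (add_le_add ?_ (Chebyshev.abs_eval_T_real_le_one n hx))
    rw [abs_mul]
    exact (mul_le_of_le_one_left (abs_nonneg _) hx).trans ih

lemma abs_eval_U_sub_one_le {x : ℝ} (hx : |x| ≤ 1) (j : ℤ) :
    |(Chebyshev.U ℝ (j - 1)).eval x| ≤ 2 ^ j.natAbs := by
  have hpow (n : ℕ) : (n : ℝ) ≤ 2 ^ n := mod_cast Nat.lt_two_pow_self.le
  obtain ⟨n, rfl | rfl⟩ := j.eq_nat_or_neg
  · simpa using (abs_eval_U_natCast_sub_one_le hx n).trans (hpow n)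
  · simpa [Chebyshev.U_neg_sub_one] using
      (abs_eval_U_natCast_sub_one_le hx n).trans (hpow n)

lemma eval_U_sub_one_mul_self {x : ℝ} (hx : x = 1 ∨ x = -1) (j : ℤ) :
    (Chebyshev.U ℝ (j - 1)).eval x * x = j * x ^ j := by
  obtain rfl | rfl := hx
  · simp
  · rw [Chebyshev.U_eval_neg_one, Int.cast_negOnePow, zpow_sub_one₀ (by norm_num)]
    push_cast
    ring

lemma hasSum_mul_eval_U_mul_im {u : ℂ} (hu : ‖u‖ = 1) {b : ℤ → ℝ} {s : ℂ}
    (h : HasSum (fun j ↦ (b j : ℂ) * u ^ j) s) :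
    HasSum (fun j ↦ b j * (Chebyshev.U ℝ (j - 1)).eval u.re * u.im) s.im := by
  simpa only [Complex.im_ofReal_mul, im_zpow hu, mul_assoc] using Complex.hasSum_im h

end Chebyshev

section Theta

variable {t : ℝ}

lemma ofReal_thetaTerm_mul_zpow (q x y : ℝ) (u : ℂ) (j : ℤ) :
    ((thetaTerm q x y j : ℝ) : ℂ) * u ^ j = thetaTerm (q : ℂ) (x * u) (y * u⁻¹) j := by
  rw [thetaTerm_mul_mul_inv]
  exact congrArg (· * u ^ j) (map_thetaTerm q x y Complex.ofRealHom j)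

lemma qPochhammerInf_self_pos (ht0 : 0 ≤ t) (ht1 : t < 1) : 0 < qPochhammerInf t t := by
  have ht : ‖t‖ < 1 := by rwa [Real.norm_of_nonneg ht0]
  refine lt_of_le_of_ne' (ge_of_tendsto' (tendsto_qPochhammer ht t) fun n ↦ ?_)
    (qPochhammerInf_self_ne_zero ht)
  refine Finset.prod_nonneg fun i _ ↦ ?_
  rw [← pow_succ']
  exact sub_nonneg.2 (pow_le_one₀ ht0 ht1.le)

lemma hasSum_thetaTerm_mul_eval_U_of_im_ne_zero (ht0 : 0 ≤ t) (ht1 : t < 1) {u : ℂ} (hu : ‖u‖ = 1)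
    (hu' : u.im ≠ 0) :
    HasSum (fun j ↦ thetaTerm t 1 t j * (Chebyshev.U ℝ (j - 1)).eval u.re)
      (qPochhammerInf t t * ‖qPochhammerInf (-(u * t)) (t : ℂ)‖ ^ 2) := by
  have ht : ‖t‖ < 1 := by rwa [Real.norm_of_nonneg ht0]
  have htC : ‖(t : ℂ)‖ < 1 := by rwa [Complex.norm_real]
  set P := qPochhammerInf (-(u * t)) (t : ℂ) with hP
  have hQ : qPochhammerInf (t : ℂ) t = (qPochhammerInf t t : ℝ) :=
    (map_qPochhammerInf (φ := Complex.ofRealHom) Complex.continuous_ofReal ht t).symm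
  have hPu : qPochhammerInf (-u) (t : ℂ) = (1 + u) * P := by
    rw [qPochhammerInf_eq_one_sub_mul htC, sub_neg_eq_add, neg_mul]
  have hPu' : qPochhammerInf (-(t * u⁻¹)) (t : ℂ) = starRingEnd ℂ P := by
    rw [hP, map_qPochhammerInf Complex.continuous_conj htC, map_neg, map_mul, Complex.conj_ofReal,
      Complex.inv_eq_conj hu, mul_comm]
  have hsum : HasSum (fun j ↦ ((thetaTerm t 1 t j : ℝ) : ℂ) * u ^ j)
      (((qPochhammerInf t t * ‖P‖ ^ 2 : ℝ) : ℂ) * (1 + u)) := by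
    have hu0 : u ≠ 0 := norm_ne_zero_iff.1 (hu ▸ one_ne_zero)
    have h := hasSum_thetaTerm htC (show u * (t * u⁻¹) = t by field_simp)
    rw [hQ, hPu, hPu'] at h
    convert! h using 1
    · funext j
      rw [ofReal_thetaTerm_mul_zpow, Complex.ofReal_one, one_mul]
    · rw [mul_assoc (1 + u), Complex.mul_conj']
      push_cast
      ring
  have him := hasSum_mul_eval_U_mul_im hu hsum
  rw [Complex.im_ofReal_mul, Complex.add_im, Complex.one_im, zero_add] at him
  exact (hasSum_mul_right_iff hu').1 him

lemma summable_thetaTerm (ht0 : 0 ≤ t) (ht1 : t < 1) (x y : ℝ) : Summable (thetaTerm t x y) :=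
  (summable_norm_thetaTerm (by rwa [Real.norm_of_nonneg ht0]) x y).of_norm

lemma thetaTerm_nonneg {q x y : ℝ} (hq : 0 ≤ q) (hx : 0 ≤ x) (hy : 0 ≤ y) (j : ℤ) :
    0 ≤ thetaTerm q x y j := by
  unfold thetaTerm
  positivity

lemma norm_smul_le_thetaTerm_mul_two {E : Type*} [NormedAddCommGroup E] [NormedSpace ℝ E]
    {b q x y : ℝ} {w : E} {j : ℤ} (hb : |b| ≤ thetaTerm q x y j) (hw : ‖w‖ ≤ 2 ^ j.natAbs) :
    ‖b • w‖ ≤ thetaTerm q (x * 2) (y * 2) j := by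
  rw [norm_smul, thetaTerm_mul_mul]
  exact mul_le_mul hb hw (norm_nonneg w) ((abs_nonneg b).trans hb)

lemma tendsto_tsum_smul_of_abs_le_thetaTerm {ι E : Type*} [NormedAddCommGroup E] [NormedSpace ℝ E]
    [CompleteSpace E] {l : Filter ι} {q x y : ℝ} (hq : ‖q‖ < 1) {b : ι → ℤ → ℝ} {b₀ : ℤ → ℝ}
    {w : ι → ℤ → E} {w₀ : ℤ → E} (hb : ∀ᶠ i in l, ∀ j, |b i j| ≤ thetaTerm q x y j)
    (hb₀ : ∀ j, Tendsto (b · j) l (𝓝 (b₀ j))) (hw : ∀ᶠ i in l, ∀ j, ‖w i j‖ ≤ 2 ^ j.natAbs)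
    (hw₀ : ∀ j, Tendsto (w · j) l (𝓝 (w₀ j))) :
    Tendsto (fun i ↦ ∑' j, b i j • w i j) l (𝓝 (∑' j, b₀ j • w₀ j)) := by
  refine tendsto_tsum_of_dominated_convergence
    (summable_norm_thetaTerm hq (x * 2) (y * 2)).of_norm (fun j ↦ (hb₀ j).smul (hw₀ j)) ?_
  filter_upwards [hb, hw] with i hbi hwi j
  exact norm_smul_le_thetaTerm_mul_two (hbi j) (hwi j)

lemma continuousOn_tsum_thetaTerm_mul_eval_U (ht0 : 0 ≤ t) (ht1 : t < 1) :
    ContinuousOn (fun x ↦ ∑' j, thetaTerm t 1 t j * (Chebyshev.U ℝ (j - 1)).eval x)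
      (Set.Icc (-1) 1) :=
  continuousOn_tsum (fun j ↦ by fun_prop) (summable_thetaTerm ht0 ht1 (1 * 2) (t * 2))
    fun j x hx ↦ norm_smul_le_thetaTerm_mul_two
      (abs_of_nonneg (thetaTerm_nonneg ht0 zero_le_one ht0 j)).le
      (abs_eval_U_sub_one_le (abs_le.2 hx) j)

lemma pow_three_le_tsum_thetaTerm_mul_eval_U (ht0 : 0 ≤ t) (ht1 : t < 1) {x : ℝ} (hx : |x| ≤ 1) :
    qPochhammerInf t t ^ 3 ≤
      ∑' j, thetaTerm t 1 t j * (Chebyshev.U ℝ (j - 1)).eval x := by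
  have hQ := qPochhammerInf_self_pos ht0 ht1
  have hcont := continuousOn_tsum_thetaTerm_mul_eval_U ht0 ht1
  rw [← closure_Ioo (by norm_num : (-1 : ℝ) ≠ 1)] at hcont
  refine le_on_closure (f := fun _ ↦ qPochhammerInf t t ^ 3) (fun y hy ↦ ?_) continuousOn_const
    hcont (x := x) (by rw [closure_Ioo (by norm_num)]; exact abs_le.1 hx)
  have hy' : 0 < 1 - y ^ 2 := by nlinarith [hy.1, hy.2]
  set u : ℂ := ⟨y, √(1 - y ^ 2)⟩
  have hu : ‖u‖ = 1 := by
    rw [← sq_eq_sq₀ (norm_nonneg u) zero_le_one, Complex.sq_norm, Complex.normSq_mk,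
      Real.mul_self_sqrt hy'.le]
    ring
  have hP : qPochhammerInf t t ≤ ‖qPochhammerInf (-(u * t)) (t : ℂ)‖ := by
    simpa [hu, abs_of_nonneg ht0] using
      qPochhammerInf_norm_le_norm (q := (t : ℂ)) (x := -(u * t))
        (by simpa [abs_of_nonneg ht0] using ht1) (by simpa [hu, abs_of_nonneg ht0] using ht1.le)
  rw [(hasSum_thetaTerm_mul_eval_U_of_im_ne_zero ht0 ht1 hu (Real.sqrt_pos.2 hy').ne').tsum_eq,
    pow_succ']
  gcongr

lemma tsum_thetaTerm_mul_eval_U_swap (q x y r : ℝ) :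
    ∑' j, thetaTerm q y x j * (Chebyshev.U ℝ (j - 1)).eval r =
      -∑' j, thetaTerm q x y j * (Chebyshev.U ℝ (j - 1)).eval r := by
  rw [← tsum_neg, ← (Equiv.neg ℤ).tsum_eq]
  simp [thetaTerm_neg, Chebyshev.U_neg_sub_one]

/-- A zero on the unit circle forces `x = 1` or `y = 1`, hence `(x, y) = (1, t)` or `(t, 1)`. -/
lemma tsum_thetaTerm_mul_eval_U_ne_zero {x y : ℝ} (hx0 : 0 ≤ x) (hx1 : x ≤ 1) (hy0 : 0 ≤ y)
    (hy1 : y ≤ 1) (hxy : x * y = t) (ht1 : t < 1) {u : ℂ} (hu : ‖u‖ = 1)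
    (h : ∑' j, ((thetaTerm t x y j : ℝ) : ℂ) * u ^ j = 0) :
    ∑' j, thetaTerm t x y j * (Chebyshev.U ℝ (j - 1)).eval u.re ≠ 0 := by
  have ht0 : 0 ≤ t := hxy ▸ mul_nonneg hx0 hy0
  have hpos := (pow_pos (qPochhammerInf_self_pos ht0 ht1) 3).trans_le
    (pow_three_le_tsum_thetaTerm_mul_eval_U ht0 ht1 (hu ▸ Complex.abs_re_le_norm u))
  have hu0 : u ≠ 0 := norm_ne_zero_iff.1 (hu ▸ one_ne_zero)
  have heq_one {c : ℝ} {v : ℂ} {i : ℕ} (hc0 : 0 ≤ c) (hc1 : c ≤ 1) (hv : ‖v‖ = 1)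
      (h : 1 + c * v * (t : ℂ) ^ i = 0) : c = 1 := by
    have hnorm : c * t ^ i = 1 := by
      have := congrArg norm (eq_neg_of_add_eq_zero_right h)
      simpa [hv, abs_of_nonneg, hc0, ht0] using this
    exact le_antisymm hc1 (hnorm ▸ mul_le_of_le_one_right hc0 (pow_le_one₀ ht0 ht1.le))
  simp only [ofReal_thetaTerm_mul_zpow] at h
  obtain ⟨i, hi | hi⟩ := exists_eq_zero_of_tsum_thetaTerm_eq_zero
    (by simpa [abs_of_nonneg ht0] using ht1)
    (by rw [mul_mul_mul_comm, mul_inv_cancel₀ hu0, ← hxy]; simp) h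
  · obtain rfl := heq_one hx0 hx1 hu hi
    obtain rfl : y = t := by simpa using hxy
    exact hpos.ne'
  · obtain rfl := heq_one hy0 hy1 (by simp [hu]) hi
    obtain rfl : x = t := by simpa using hxy
    rw [tsum_thetaTerm_mul_eval_U_swap]
    exact neg_ne_zero.2 hpos.ne'

end Theta

section GeometricDecay

lemma exists_forall_le_mul_add {σ : ℕ → ℝ} (hσ : ∀ k, 0 < σ k)
    (h : ∀ᶠ k in atTop, σ k ≤ σ (k + 1)) : ∃ C, ∀ k n, σ k ≤ C * σ (k + n) := by
  obtain ⟨K, hK⟩ := eventually_atTop.1 h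
  clear h
  induction K generalizing σ with
  | zero =>
    have hmono : Monotone σ := monotone_nat_of_le_succ fun k ↦ hK k k.zero_le
    exact ⟨1, fun k n ↦ by simpa using hmono (k.le_add_right n)⟩
  | succ K ih =>
    obtain ⟨C, hC⟩ := ih (fun k ↦ hσ (k + 1)) fun k hk ↦ hK (k + 1) (by omega)
    refine ⟨max (max 1 C) (σ 0 / σ 1 * C), fun k n ↦ ?_⟩
    rcases k with _ | k
    · rcases n with _ | n
      · exact le_mul_of_one_le_left (hσ 0).le ((le_max_left _ _).trans (le_max_left _ _))
      · calc σ 0 = σ 0 / σ 1 * σ 1 := (div_mul_cancel₀ _ (hσ 1).ne').symm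
          _ ≤ σ 0 / σ 1 * (C * σ (0 + n + 1)) :=
            mul_le_mul_of_nonneg_left (hC 0 n) (div_pos (hσ 0) (hσ 1)).le
          _ = σ 0 / σ 1 * C * σ (0 + (n + 1)) := (mul_assoc _ _ _).symm
          _ ≤ _ := mul_le_mul_of_nonneg_right (le_max_right _ _) (hσ _).le
    · refine (hC k n).trans ?_
      rw [show k + n + 1 = k + 1 + n by ring]
      exact mul_le_mul_of_nonneg_right ((le_max_right _ _).trans (le_max_left _ _)) (hσ _).le

variable {ρ : ℕ → ℝ} {t : ℝ}

lemma exists_forall_le_mul_pow_mul (hρ : ∀ k, 0 < ρ k) (ht1 : t < 1)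
    (ht : Tendsto (fun k ↦ ρ k / ρ (k + 1)) atTop (𝓝 t)) :
    ∃ T C, 0 ≤ T ∧ T < 1 ∧ ∀ k n, ρ k ≤ C * T ^ n * ρ (k + n) := by
  obtain ⟨T, htT, hT1⟩ := exists_between ht1
  have ht0 : 0 ≤ t := ge_of_tendsto' ht fun k ↦ (div_pos (hρ k) (hρ (k + 1))).le
  have hT0 : 0 < T := ht0.trans_lt htT
  have hmono : ∀ᶠ k in atTop, ρ k * T ^ k ≤ ρ (k + 1) * T ^ (k + 1) := by
    filter_upwards [ht.eventually_le_const htT] with k hk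
    rw [div_le_iff₀ (hρ _)] at hk
    rw [pow_succ', ← mul_assoc, mul_comm (ρ (k + 1))]
    gcongr
  obtain ⟨C, hC⟩ := exists_forall_le_mul_add (fun k ↦ mul_pos (hρ k) (pow_pos hT0 k)) hmono
  refine ⟨T, C, hT0.le, hT1, fun k n ↦ le_of_mul_le_mul_right ?_ (pow_pos hT0 k)⟩
  calc ρ k * T ^ k ≤ C * (ρ (k + n) * T ^ (k + n)) := hC k n
    _ = C * T ^ n * ρ (k + n) * T ^ k := by ring

lemma tendsto_div_add_of_tendsto_div_succ (hρ : ∀ k, ρ k ≠ 0)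
    (ht : Tendsto (fun k ↦ ρ k / ρ (k + 1)) atTop (𝓝 t)) (n : ℕ) :
    Tendsto (fun k ↦ ρ k / ρ (k + n)) atTop (𝓝 (t ^ n)) := by
  induction n with
  | zero => simp [hρ]
  | succ n ih =>
    refine (ih.mul (ht.comp (tendsto_add_atTop_nat n))).congr fun k ↦ ?_
    exact div_mul_div_cancel₀ (hρ (k + n))

lemma tendsto_atTop_of_tendsto_div_succ (hρ : ∀ k, 0 < ρ k) (ht1 : t < 1)
    (ht : Tendsto (fun k ↦ ρ k / ρ (k + 1)) atTop (𝓝 t)) : Tendsto ρ atTop atTop := by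
  have hsum : Summable fun k ↦ (ρ k)⁻¹ :=
    summable_of_ratio_test_tendsto_lt_one ht1 (.of_forall fun k ↦ inv_ne_zero (hρ k).ne') <|
      ht.congr fun k ↦ by
        rw [norm_inv, norm_inv, Real.norm_of_nonneg (hρ _).le, Real.norm_of_nonneg (hρ _).le,
          inv_div_inv]
  have hinv : Tendsto (fun k ↦ (ρ k)⁻¹) atTop (𝓝[>] 0) :=
    tendsto_nhdsWithin_iff.2 ⟨hsum.tendsto_atTop_zero, .of_forall fun k ↦ inv_pos.2 (hρ k)⟩
  exact hinv.inv_tendsto_nhdsGT_zero.congr fun k ↦ inv_inv (ρ k)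

lemma exists_le_lt_succ_of_tendsto_atTop (h : Tendsto ρ atTop atTop) :
    ∃ m : ℝ → ℕ, Tendsto m atTop atTop ∧ ∀ᶠ r in atTop, ρ (m r) ≤ r ∧ r < ρ (m r + 1) := by
  have hex (r : ℝ) (hr : ρ 0 ≤ r) : ∃ m, ρ m ≤ r ∧ r < ρ (m + 1) := by
    by_contra! hle
    have hbdd (k : ℕ) : ρ k ≤ r := k.rec hr hle
    obtain ⟨k, hk⟩ := (h.eventually_gt_atTop r).exists
    exact hk.not_ge (hbdd k)
  choose! m hm using hex
  refine ⟨m, tendsto_atTop.2 fun N ↦ ?_, (eventually_ge_atTop (ρ 0)).mono hm⟩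
  obtain ⟨B, hB⟩ := ((Set.finite_le_nat N).image ρ).bddAbove
  filter_upwards [eventually_ge_atTop B, eventually_ge_atTop (ρ 0)] with r hrB hr
  by_contra! hlt
  exact (hm r hr).2.not_ge ((hB ⟨m r + 1, hlt, rfl⟩).trans hrB)

end GeometricDecay

section RescaledCoeff

/-- The ratio `a k / a (k + 1)` of consecutive coefficients: the radius at which the terms of
degree `k` and `k + 1` of `∑ a k z ^ k` have the same modulus. -/
noncomputable def coeffRatio (a : ℕ → ℝ) (k : ℕ) : ℝ :=
  a k / a (k + 1)

/-- The coefficient of `u ^ j` when `∑ a k z ^ k`, with `z = r u`, is divided by its term of degree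
`ν`, that is `a (ν + j) r ^ j / a ν`; it is `0` when `ν + j` is negative. -/
noncomputable def rescaledCoeff (a : ℕ → ℝ) (ν : ℕ) (r : ℝ) (j : ℤ) : ℝ :=
  if 0 ≤ ν + j then a (ν + j).toNat * r ^ j / a ν else 0

variable {a : ℕ → ℝ}

lemma coeffRatio_pos (ha : ∀ k, 0 < a k) (k : ℕ) : 0 < coeffRatio a k :=
  div_pos (ha k) (ha (k + 1))

lemma inv_secondQuotient_add_two (a : ℕ → ℝ) (k : ℕ) :
    (secondQuotient a (k + 2))⁻¹ = coeffRatio a k / coeffRatio a (k + 1) := by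
  simp only [secondQuotient, coeffRatio, show k + 2 - 1 = k + 1 from rfl, Nat.add_sub_cancel,
    inv_div, div_div_div_eq, sq]

lemma rescaledCoeff_natCast (ha : ∀ k, a k ≠ 0) (ν : ℕ) (r : ℝ) (n : ℕ) :
    rescaledCoeff a ν r n = ∏ i ∈ Finset.range n, r / coeffRatio a (ν + i) := by
  induction n with
  | zero => simp [rescaledCoeff, ha]
  | succ n ih =>
    rw [Finset.prod_range_succ, ← ih]
    have hn := ha (ν + n)
    simp only [rescaledCoeff, coeffRatio, ← Nat.cast_add, Int.toNat_natCast, zpow_natCast,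
      Nat.cast_nonneg, if_true, ← add_assoc]
    field_simp
    ring

lemma rescaledCoeff_neg_natCast (ha : ∀ k, a k ≠ 0) {m n : ℕ} (hn : n ≤ m + 1) (r : ℝ) :
    rescaledCoeff a (m + 1) r (-n) = ∏ i ∈ Finset.range n, coeffRatio a (m - i) / r := by
  induction n with
  | zero => simpa [rescaledCoeff, ha] using Int.natCast_nonneg (m + 1)
  | succ n ih =>
    obtain ⟨k, rfl⟩ := Nat.exists_eq_add_of_le' (Nat.succ_le_succ_iff.1 hn)
    rw [Finset.prod_range_succ, ← ih (by omega)]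
    have hk := ha (k + 1)
    have hidx : ((k + n + 1 : ℕ) : ℤ) + -(n : ℕ) = (k + 1 : ℕ) := by push_cast; ring
    have hidx' : ((k + n + 1 : ℕ) : ℤ) + -(n + 1 : ℕ) = k := by push_cast; ring
    simp only [rescaledCoeff, coeffRatio, hidx, hidx', Int.toNat_natCast, zpow_neg, zpow_natCast,
      Nat.cast_nonneg, if_true, Nat.add_sub_cancel]
    field_simp
    ring

lemma rescaledCoeff_of_lt {ν : ℕ} {j : ℤ} (h : ν + j < 0) (r : ℝ) : rescaledCoeff a ν r j = 0 :=
  if_neg h.not_ge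

lemma abs_rescaledCoeff_le_thetaTerm (ha : ∀ k, 0 < a k) {T C : ℝ} (hT : 0 ≤ T)
    (hTC : ∀ k n, coeffRatio a k ≤ C * T ^ n * coeffRatio a (k + n)) {m : ℕ} {r : ℝ}
    (hr : coeffRatio a m ≤ r) (hr' : r ≤ coeffRatio a (m + 1)) (j : ℤ) :
    |rescaledCoeff a (m + 1) r j| ≤ thetaTerm T C C j := by
  have hρ := coeffRatio_pos ha
  have hr0 : 0 < r := (hρ m).trans_le hr
  have hC : 0 ≤ C := by
    have := (hρ 0).le.trans (hTC 0 0)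
    simpa [hρ] using this
  obtain ⟨n, rfl | rfl⟩ := j.eq_nat_or_neg
  · rw [rescaledCoeff_natCast (fun k ↦ (ha k).ne'), thetaTerm_natCast_eq_prod,
      abs_of_nonneg (Finset.prod_nonneg fun i _ ↦ (div_pos hr0 (hρ _)).le)]
    exact Finset.prod_le_prod (fun i _ ↦ (div_pos hr0 (hρ _)).le) fun i _ ↦
      (div_le_iff₀ (hρ _)).2 (hr'.trans (hTC _ _))
  rcases le_or_gt n (m + 1) with hn | hn
  · rw [rescaledCoeff_neg_natCast (fun k ↦ (ha k).ne') hn, thetaTerm_neg, thetaTerm_natCast_eq_prod,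
      abs_of_nonneg (Finset.prod_nonneg fun i _ ↦ (div_pos (hρ _) hr0).le)]
    refine Finset.prod_le_prod (fun i _ ↦ (div_pos (hρ _) hr0).le) fun i hi ↦ ?_
    have hi : m - i + i = m := by have := Finset.mem_range.1 hi; omega
    rw [div_le_iff₀ hr0]
    calc coeffRatio a (m - i) ≤ C * T ^ i * coeffRatio a (m - i + i) := hTC _ _
      _ ≤ C * T ^ i * r := by rw [hi]; gcongr
  · rw [rescaledCoeff_of_lt (by omega), abs_zero]
    exact thetaTerm_nonneg hT hC hC _

lemma tendsto_rescaledCoeff {ι : Type*} {l : Filter ι} (ha : ∀ k, a k ≠ 0) {t x y : ℝ}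
    (ht : Tendsto (fun k ↦ coeffRatio a k / coeffRatio a (k + 1)) atTop (𝓝 t)) {m : ι → ℕ}
    (hm : Tendsto m l atTop) {r : ι → ℝ}
    (hx : Tendsto (fun i ↦ r i / coeffRatio a (m i + 1)) l (𝓝 x))
    (hy : Tendsto (fun i ↦ coeffRatio a (m i) / r i) l (𝓝 y)) (j : ℤ) :
    Tendsto (fun i ↦ rescaledCoeff a (m i + 1) (r i) j) l (𝓝 (thetaTerm t x y j)) := by
  have hρ (k : ℕ) : coeffRatio a k ≠ 0 := div_ne_zero (ha k) (ha (k + 1))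
  have hpow := tendsto_div_add_of_tendsto_div_succ hρ ht
  obtain ⟨n, rfl | rfl⟩ := j.eq_nat_or_neg
  · simp only [rescaledCoeff_natCast ha, thetaTerm_natCast_eq_prod]
    refine tendsto_finsetProd _ fun k _ ↦
      (hx.mul ((hpow k).comp ((tendsto_add_atTop_nat 1).comp hm))).congr fun i ↦ ?_
    exact div_mul_div_cancel₀ (hρ _)
  · rw [thetaTerm_neg, thetaTerm_natCast_eq_prod]
    have hprod : Tendsto (fun i ↦ ∏ k ∈ Finset.range n, coeffRatio a (m i - k) / r i) l
        (𝓝 (∏ k ∈ Finset.range n, y * t ^ k)) := by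
      refine tendsto_finsetProd _ fun k _ ↦
        (hy.mul ((hpow k).comp ((tendsto_sub_atTop_nat k).comp hm))).congr' ?_
      filter_upwards [hm.eventually_ge_atTop k] with i hi
      simp only [Function.comp_apply, Nat.sub_add_cancel hi]
      rw [mul_comm, div_mul_div_cancel₀ (hρ _)]
    refine hprod.congr' ?_
    filter_upwards [hm.eventually_ge_atTop n] with i hi
    exact (rescaledCoeff_neg_natCast ha (by omega) (r i)).symm

end RescaledCoeff

section PowerSeries

variable {a : ℕ → ℝ} {f : ℂ → ℂ}

lemma norm_ofReal_mul_pow_le (a : ℕ → ℝ) (k : ℕ) {w : ℂ} {R : ℝ} (hw : ‖w‖ ≤ R) :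
    ‖(a k : ℂ) * w ^ k‖ ≤ ‖(a k : ℂ) * (R : ℂ) ^ k‖ := by
  have hR : ‖w‖ ≤ ‖(R : ℂ)‖ := hw.trans (by simpa using le_abs_self R)
  rw [norm_mul, norm_mul, norm_pow, norm_pow]
  gcongr

lemma differentiable_of_hasSum_pow (hf : ∀ z : ℂ, HasSum (fun k ↦ (a k : ℂ) * z ^ k) (f z)) :
    Differentiable ℂ f := by
  intro z
  obtain ⟨R, hR⟩ := exists_gt ‖z‖
  have hsum : DifferentiableOn ℂ (fun w ↦ ∑' k, (a k : ℂ) * w ^ k) (Metric.ball 0 R) :=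
    Complex.differentiableOn_tsum_of_summable_norm (hf R).summable.norm (fun k ↦ by fun_prop)
      Metric.isOpen_ball fun k w hw ↦ norm_ofReal_mul_pow_le a k (mem_ball_zero_iff.1 hw).le
  simp only [(hf _).tsum_eq] at hsum
  exact hsum.differentiableAt (Metric.isOpen_ball.mem_nhds (mem_ball_zero_iff.2 hR))

lemma hasSum_natCast_mul_pow (hf : ∀ z : ℂ, HasSum (fun k ↦ (a k : ℂ) * z ^ k) (f z)) (z : ℂ) :
    HasSum (fun k : ℕ ↦ (k : ℂ) * ((a k : ℂ) * z ^ k)) (z * deriv f z) := by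
  obtain ⟨R, hR⟩ := exists_gt ‖z‖
  have hsum := Complex.hasSum_deriv_of_summable_norm (F := fun k w ↦ (a k : ℂ) * w ^ k)
    (hf R).summable.norm (fun k ↦ by fun_prop) Metric.isOpen_ball
    (fun k w hw ↦ norm_ofReal_mul_pow_le a k (mem_ball_zero_iff.1 hw).le) (mem_ball_zero_iff.2 hR)
  simp only [(hf _).tsum_eq] at hsum
  refine (hsum.mul_left z).congr_fun fun k ↦ ?_
  obtain _ | k := k
  · simp
  · simp only [deriv_const_mul_field', deriv_pow_field, Nat.add_sub_cancel]
    ring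

lemma hasSum_rescaledCoeff_mul_zpow {r : ℝ} {u : ℂ} (hr : r ≠ 0) (hu : u ≠ 0) (ν : ℕ) {w : ℤ → ℂ}
    (h : HasSum (fun k : ℕ ↦ w (k - ν) * ((a k : ℂ) * (r * u) ^ k)) 0) :
    HasSum (fun j ↦ (rescaledCoeff a ν r j : ℂ) * (w j * u ^ j)) 0 := by
  have hinj : Function.Injective fun k : ℕ ↦ (k : ℤ) - ν := fun k l hkl ↦ by simpa using hkl
  refine (hinj.hasSum_iff fun j hj ↦ ?_).1 ?_
  · have hneg : (ν : ℤ) + j < 0 := by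
      by_contra! hnonneg
      exact hj ⟨(ν + j).toNat, by simp [hnonneg]⟩
    simp [rescaledCoeff_of_lt hneg]
  · have hscaled := h.mul_left ((a ν : ℂ) * (r * u) ^ ν)⁻¹
    rw [mul_zero] at hscaled
    refine hscaled.congr_fun fun k ↦ ?_
    have hr' : (r : ℂ) ≠ 0 := Complex.ofReal_ne_zero.2 hr
    simp only [Function.comp_apply, rescaledCoeff, add_sub_cancel, Nat.cast_nonneg, if_true,
      Int.toNat_natCast, Complex.ofReal_div, Complex.ofReal_mul, Complex.ofReal_zpow,
      zpow_sub₀ hr', zpow_sub₀ hu, zpow_natCast, mul_pow, mul_inv]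
    field_simp

variable {r : ℝ} {u : ℂ}

lemma hasSum_rescaledCoeff_mul_zpow_of_eq_zero
    (hf : ∀ z : ℂ, HasSum (fun k ↦ (a k : ℂ) * z ^ k) (f z)) (hr : r ≠ 0) (hu : u ≠ 0)
    (h : f (r * u) = 0) (ν : ℕ) : HasSum (fun j ↦ (rescaledCoeff a ν r j : ℂ) * u ^ j) 0 := by
  have hf0 := hf (r * u)
  rw [h] at hf0
  simpa only [one_mul] using
    hasSum_rescaledCoeff_mul_zpow hr hu ν (w := fun _ ↦ 1) (by simpa only [one_mul] using hf0)

lemma hasSum_rescaledCoeff_mul_eval_U_of_deriv_eq_zero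
    (hf : ∀ z : ℂ, HasSum (fun k ↦ (a k : ℂ) * z ^ k) (f z)) (hr : r ≠ 0) (hu : ‖u‖ = 1)
    (him : u.im = 0) (h : f (r * u) = 0) (hderiv : deriv f (r * u) = 0) (ν : ℕ) :
    HasSum (fun j ↦ rescaledCoeff a ν r j * (Chebyshev.U ℝ (j - 1)).eval u.re) 0 := by
  obtain ⟨x, rfl⟩ : ∃ x : ℝ, (x : ℂ) = u := ⟨u.re, Complex.ext rfl him.symm⟩
  have hx : x = 1 ∨ x = -1 := eq_or_eq_neg_of_abs_eq (by simpa using hu)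
  have hx0 : x ≠ 0 := by rintro rfl; simp at hx
  have hshift : HasSum (fun k : ℕ ↦ (((k : ℤ) - ν : ℤ) : ℂ) * ((a k : ℂ) * (r * x) ^ k)) 0 := by
    have := (hasSum_natCast_mul_pow hf (r * x)).sub ((hf (r * x)).mul_left (ν : ℂ))
    rw [h, hderiv, mul_zero, mul_zero, sub_zero] at this
    exact this.congr_fun fun k ↦ by push_cast; ring
  have hsum := hasSum_rescaledCoeff_mul_zpow hr (Complex.ofReal_ne_zero.2 hx0) ν
    (w := fun j ↦ (j : ℂ)) hshift
  refine (hasSum_mul_right_iff hx0).1 ?_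
  rw [zero_mul, ← Complex.hasSum_ofReal, Complex.ofReal_zero]
  refine hsum.congr_fun fun j ↦ ?_
  rw [Complex.ofReal_re, mul_assoc, eval_U_sub_one_mul_self hx]
  push_cast
  rfl

lemma hasSum_rescaledCoeff_mul_eval_U_of_not_simple
    (hf : ∀ z : ℂ, HasSum (fun k ↦ (a k : ℂ) * z ^ k) (f z)) (hr : r ≠ 0) (hu : ‖u‖ = 1)
    (h : f (r * u) = 0) (hbad : ¬((r * u).im = 0 ∧ IsSimpleZero f (r * u))) (ν : ℕ) :
    HasSum (fun j ↦ rescaledCoeff a ν r j * (Chebyshev.U ℝ (j - 1)).eval u.re) 0 := by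
  have hu0 : u ≠ 0 := norm_ne_zero_iff.1 (hu ▸ one_ne_zero)
  by_cases him : u.im = 0
  · have han : AnalyticAt ℂ f (r * u) := (differentiable_of_hasSum_pow hf).analyticAt _
    refine hasSum_rescaledCoeff_mul_eval_U_of_deriv_eq_zero hf hr hu him h ?_ ν
    by_contra hderiv
    exact hbad ⟨by simp [him], han, han.analyticOrderAt_eq_one_of_zero_deriv_ne_zero h hderiv⟩
  · have hsum := hasSum_mul_eval_U_mul_im hu
      (hasSum_rescaledCoeff_mul_zpow_of_eq_zero hf hr hu0 h ν)
    exact (hasSum_mul_right_iff him).1 (by simpa only [zero_mul, Complex.zero_im] using hsum)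

end PowerSeries

section Zeros

variable {a : ℕ → ℝ} {f : ℂ → ℂ} {t : ℝ}

lemma tsum_thetaTerm_smul_eq_zero {ι E : Type*} [NormedAddCommGroup E] [NormedSpace ℝ E]
    [CompleteSpace E] {l : Filter ι} [l.NeBot] (ha : ∀ k, 0 < a k) (ht1 : t < 1)
    (ht : Tendsto (fun k ↦ coeffRatio a k / coeffRatio a (k + 1)) atTop (𝓝 t)) {m : ι → ℕ}
    (hm : Tendsto m l atTop) {r : ι → ℝ}
    (hr : ∀ᶠ i in l, coeffRatio a (m i) ≤ r i ∧ r i < coeffRatio a (m i + 1)) {x y : ℝ}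
    (hx : Tendsto (fun i ↦ r i / coeffRatio a (m i + 1)) l (𝓝 x))
    (hy : Tendsto (fun i ↦ coeffRatio a (m i) / r i) l (𝓝 y)) {w : ι → ℤ → E} {w₀ : ℤ → E}
    (hw : ∀ᶠ i in l, ∀ j, ‖w i j‖ ≤ 2 ^ j.natAbs) (hw₀ : ∀ j, Tendsto (w · j) l (𝓝 (w₀ j)))
    (hzero : ∀ᶠ i in l, HasSum (fun j ↦ rescaledCoeff a (m i + 1) (r i) j • w i j) 0) :
    ∑' j, thetaTerm t x y j • w₀ j = 0 := by
  obtain ⟨T, C, hT0, hT1, hTC⟩ := exists_forall_le_mul_pow_mul (coeffRatio_pos ha) ht1 ht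
  have hlim := tendsto_tsum_smul_of_abs_le_thetaTerm (by rwa [Real.norm_of_nonneg hT0])
    (hr.mono fun i hi ↦ abs_rescaledCoeff_le_thetaTerm ha hT0 hTC hi.1 hi.2.le)
    (tendsto_rescaledCoeff (fun k ↦ (ha k).ne') ht hm hx hy) hw hw₀
  exact tendsto_nhds_unique hlim
    (tendsto_const_nhds.congr' (hzero.mono fun i hi ↦ hi.tsum_eq.symm))

lemma exists_tendsto_of_eventually_mem {X Y : Type*} [TopologicalSpace Y] {K : Set Y}
    (hK : IsCompact K) {l : Ultrafilter X} {g : X → Y} (hg : ∀ᶠ i in l, g i ∈ K) :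
    ∃ y ∈ K, Tendsto g l (𝓝 y) :=
  hK.ultrafilter_le_nhds' (l.map g) hg

lemma not_eventually_zero_and_not_simple {l : Filter ℂ} [l.NeBot] (ha : ∀ k, 0 < a k)
    (hf : ∀ z : ℂ, HasSum (fun k ↦ (a k : ℂ) * z ^ k) (f z)) (ht1 : t < 1)
    (ht : Tendsto (fun k ↦ coeffRatio a k / coeffRatio a (k + 1)) atTop (𝓝 t)) {m : ℂ → ℕ}
    (hm : Tendsto m l atTop)
    (hr : ∀ᶠ z in l, coeffRatio a (m z) ≤ ‖z‖ ∧ ‖z‖ < coeffRatio a (m z + 1)) {x y : ℝ} {u : ℂ}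
    (hx0 : 0 ≤ x) (hx1 : x ≤ 1) (hx : Tendsto (fun z ↦ ‖z‖ / coeffRatio a (m z + 1)) l (𝓝 x))
    (hy0 : 0 ≤ y) (hy1 : y ≤ 1) (hy : Tendsto (fun z ↦ coeffRatio a (m z) / ‖z‖) l (𝓝 y))
    (hu1 : ‖u‖ = 1) (hu : Tendsto (fun z : ℂ ↦ z / ‖z‖) l (𝓝 u)) :
    ¬∀ᶠ z in l, f z = 0 ∧ ¬(z.im = 0 ∧ IsSimpleZero f z) := by
  intro hzero
  have hpolar : ∀ᶠ z : ℂ in l, ‖z‖ ≠ 0 ∧ ‖z / ‖z‖‖ = 1 ∧ ‖z‖ * (z / ‖z‖) = z := by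
    filter_upwards [hr] with z hz
    have hz0 : ‖z‖ ≠ 0 := ((coeffRatio_pos ha _).trans_le hz.1).ne'
    exact ⟨hz0, by simp [hz0], mul_div_cancel₀ z (Complex.ofReal_ne_zero.2 hz0)⟩
  have hu0 : u ≠ 0 := norm_ne_zero_iff.1 (hu1 ▸ one_ne_zero)
  have hxy : x * y = t := by
    refine tendsto_nhds_unique (hx.mul hy) ((ht.comp hm).congr' ?_)
    filter_upwards [hpolar] with z hz
    rw [div_mul_div_comm, mul_comm ‖z‖, mul_div_mul_right _ _ hz.1]
    rfl
  have hθ : ∑' j, thetaTerm t x y j • u ^ j = 0 := by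
    refine tsum_thetaTerm_smul_eq_zero ha ht1 ht hm hr hx hy (w := fun z j ↦ (z / ‖z‖) ^ j) ?_
      (fun j ↦ hu.zpow₀ j (.inl hu0)) ?_
    · filter_upwards [hpolar] with z hz j
      rw [norm_zpow, hz.2.1, one_zpow]
      exact one_le_pow₀ one_le_two
    · filter_upwards [hzero, hpolar] with z ⟨hz, _⟩ ⟨hz0, hz1, hpol⟩
      simpa only [Complex.real_smul] using hasSum_rescaledCoeff_mul_zpow_of_eq_zero hf hz0
        (norm_ne_zero_iff.1 (hz1 ▸ one_ne_zero)) (by rwa [hpol]) (m z + 1)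
  have hU : ∑' j, thetaTerm t x y j • (Chebyshev.U ℝ (j - 1)).eval u.re = 0 := by
    refine tsum_thetaTerm_smul_eq_zero ha ht1 ht hm hr hx hy
      (w := fun z j ↦ (Chebyshev.U ℝ (j - 1)).eval (z / ‖z‖).re) ?_ (fun j ↦ ?_) ?_
    · filter_upwards [hpolar] with z hz
      exact abs_eval_U_sub_one_le (hz.2.1 ▸ Complex.abs_re_le_norm _)
    · exact ((Chebyshev.U ℝ (j - 1)).continuous.tendsto _).comp
        ((Complex.continuous_re.tendsto u).comp hu)
    · filter_upwards [hzero, hpolar] with z ⟨hz, hbad⟩ ⟨hz0, hz1, hpol⟩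
      exact hasSum_rescaledCoeff_mul_eval_U_of_not_simple hf hz0 hz1 (by rwa [hpol])
        (by rwa [hpol]) _
  simp only [Complex.real_smul] at hθ
  exact tsum_thetaTerm_mul_eval_U_ne_zero hx0 hx1 hy0 hy1 hxy ht1 hu1 hθ hU

lemma eventually_cocompact_im_eq_zero_and_isSimpleZero (ha : ∀ k, 0 < a k)
    (hf : ∀ z : ℂ, HasSum (fun k ↦ (a k : ℂ) * z ^ k) (f z)) (ht1 : t < 1)
    (ht : Tendsto (fun k ↦ coeffRatio a k / coeffRatio a (k + 1)) atTop (𝓝 t)) :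
    ∀ᶠ z in cocompact ℂ, f z = 0 → z.im = 0 ∧ IsSimpleZero f z := by
  by_contra hbad
  simp only [not_eventually, Classical.not_imp] at hbad
  have := frequently_iff_neBot.1 hbad
  obtain ⟨l, hl⟩ := Ultrafilter.exists_le
    (cocompact ℂ ⊓ 𝓟 {z | f z = 0 ∧ ¬(z.im = 0 ∧ IsSimpleZero f z)})
  have hρ := coeffRatio_pos ha
  obtain ⟨m, hm, hmr⟩ :=
    exists_le_lt_succ_of_tendsto_atTop (tendsto_atTop_of_tendsto_div_succ hρ ht1 ht)
  have hnorm : Tendsto (‖·‖) (l : Filter ℂ) atTop :=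
    tendsto_norm_cocompact_atTop.mono_left (hl.trans inf_le_left)
  have hr := hnorm.eventually hmr
  obtain ⟨x, ⟨hx0, hx1⟩, hx⟩ := exists_tendsto_of_eventually_mem isCompact_Icc
    (g := fun z ↦ ‖z‖ / coeffRatio a (m ‖z‖ + 1)) <| hr.mono fun z hz ↦
      ⟨div_nonneg (norm_nonneg z) (hρ _).le, div_le_one_of_le₀ hz.2.le (hρ _).le⟩
  obtain ⟨y, ⟨hy0, hy1⟩, hy⟩ := exists_tendsto_of_eventually_mem isCompact_Icc
    (g := fun z ↦ coeffRatio a (m ‖z‖) / ‖z‖) <| hr.mono fun z hz ↦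
      ⟨div_nonneg (hρ _).le (norm_nonneg z), div_le_one_of_le₀ hz.1 (norm_nonneg z)⟩
  obtain ⟨u, hu1, hu⟩ := exists_tendsto_of_eventually_mem (isCompact_sphere (0 : ℂ) 1)
    (g := fun z ↦ z / ‖z‖) <| (hnorm.eventually_gt_atTop 0).mono fun z hz ↦ by simp [hz.ne']
  exact not_eventually_zero_and_not_simple ha hf ht1 ht (hm.comp hnorm) hr hx0 hx1 hx hy0 hy1 hy
    (mem_sphere_zero_iff_norm.1 hu1) hu (le_principal_iff.1 (hl.trans inf_le_right))

lemma finite_preimage_zero_inter {g : ℂ → ℂ} (hg : Differentiable ℂ g) {z₀ : ℂ} (h : g z₀ ≠ 0)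
    {K : Set ℂ} (hK : IsCompact K) : (g ⁻¹' {0} ∩ K).Finite := by
  have hdisc : (g ⁻¹' {0})ᶜ ∈ codiscrete ℂ :=
    AnalyticOnNhd.preimage_zero_mem_codiscrete (fun z _ ↦ hg.analyticAt z) h
  rw [mem_codiscrete', compl_compl] at hdisc
  exact (hK.inter_left (isClosed_singleton.preimage hg.continuous)).finite
    (hdisc.2.mono Set.inter_subset_left)

end Zeros

lemma exists_tendsto_inv_secondQuotient {a : ℕ → ℝ} (ha : ∀ k, 0 < a k)
    (h2 : 1 < secondQuotient a 2)
    (hq : ∀ n : ℕ, 2 ≤ n → secondQuotient a n ≤ secondQuotient a (n + 1)) :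
    ∃ t < 1, Tendsto (fun n ↦ (secondQuotient a n)⁻¹) atTop (𝓝 t) := by
  have hpos (n : ℕ) : 0 < secondQuotient a n :=
    div_pos (pow_pos (ha _) 2) (mul_pos (ha _) (ha _))
  have hanti : Antitone fun n ↦ (secondQuotient a (n + 2))⁻¹ :=
    antitone_nat_of_succ_le fun n ↦ inv_anti₀ (hpos _) (hq (n + 2) (Nat.le_add_left 2 n))
  have hbdd : BddBelow (Set.range fun n ↦ (secondQuotient a (n + 2))⁻¹) :=
    ⟨0, Set.forall_mem_range.2 fun n ↦ (inv_pos.2 (hpos _)).le⟩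
  exact ⟨_, (ciInf_le hbdd 0).trans_lt (inv_lt_one_of_one_lt₀ h2),
    (tendsto_add_atTop_iff_nat 2).1 (tendsto_atTop_ciInf hanti hbdd)⟩

theorem theorem1_general (a : ℕ → ℝ) (f : ℂ → ℂ)
    (ha : ∀ k, 0 < a k)
    (hf : ∀ z : ℂ, HasSum (fun k : ℕ => (a k : ℂ) * z ^ k) (f z))
    {t : ℝ} (ht1 : t < 1)
    (ht : Tendsto (fun n ↦ (secondQuotient a n)⁻¹) atTop (𝓝 t)) :
    {z : ℂ | f z = 0 ∧ ¬ (z.im = 0 ∧ IsSimpleZero f z)}.Finite := by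
  have hratio := ((tendsto_add_atTop_iff_nat 2).2 ht).congr (inv_secondQuotient_add_two a)
  obtain ⟨K, hK, hsub⟩ := mem_cocompact.1
    (eventually_cocompact_im_eq_zero_and_isSimpleZero ha hf ht1 hratio)
  have hf0 : f 0 ≠ 0 := by
    have h := hasSum_single (f := fun k ↦ (a k : ℂ) * 0 ^ k) 0 fun k hk ↦ by simp [hk]
    rw [(hf 0).unique h]
    simpa using (ha 0).ne'
  refine (finite_preimage_zero_inter (differentiable_of_hasSum_pow hf) hf0 hK).subset
    fun z hz ↦ ⟨hz.1, ?_⟩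
  by_contra hzK
  exact hz.2 (hsub hzK hz.1)

theorem theorem1 (a : ℕ → ℝ) (f : ℂ → ℂ)
    (ha : ∀ k, 0 < a k)
    (hf : ∀ z : ℂ, HasSum (fun k : ℕ => (a k : ℂ) * z ^ k) (f z))
    (hq₂ : 2 * (2 : ℝ) ^ (1 / 3 : ℝ) ≤ secondQuotient a 2)
    (hq : ∀ n : ℕ, 2 ≤ n → secondQuotient a n ≤ secondQuotient a (n + 1)) :
    {z : ℂ | f z = 0 ∧ ¬ (z.im = 0 ∧ IsSimpleZero f z)}.Finite := by
  have hpow : (1 : ℝ) ≤ 2 ^ (1 / 3 : ℝ) := Real.one_le_rpow one_le_two (by norm_num)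
  obtain ⟨t, ht1, ht⟩ := exists_tendsto_inv_secondQuotient ha (by linarith) hq
  exact theorem1_general a f ha hf ht1 ht
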